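/- Let $\Sigma_C,\Sigma_R,\Sigma_I$ be finite sets of concept, role and individual names with $\Sigma_I\neq\emptyset$, let $\Phi\subseteq\{O,U,\mathsf{Self}\}$ be a set of features (nominals, universal role, local reflexivity), and let $\mathcal L_\Phi$ be the corresponding extension of the description logic $\mathcal{ALC}_{reg}$ (PDL-style roles $\varepsilon$, $R\circ S$, $R\sqcup S$, $R^*$, $C?$). The semi-positive concepts ($\mathcal L^{sp}_\Phi$) and the role classes $\mathcal L^{sp}_{\Phi,\exists}$, $\mathcal L^{sp}_{\Phi,\forall}$ are defined by simultaneous recursion: role names belong to both role classes; both contain $\varepsilon$ and are closed under $\circ,\sqcup,{}^*$; for $C$ semi-positive, $C?\in\mathcal L^{sp}_{\Phi,\exists}$ and $(\neg C)?\in\mathcal L^{sp}_{\Phi,\forall}$; semi-positive concepts are concept names, $\top$, $\bot$, $C\sqcup D$, $C\sqcap D$, $\exists R.C$, $\forall S.C$ ($R\in\mathcal L^{sp}_{\Phi,\exists}$, $S\in\mathcal L^{sp}_{\Phi,\forall}$), together with $\{a\}$ if $O\in\Phi$, $\exists r.\mathsf{Self}$ if $\mathsf{Self}\in\Phi$, and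 $\exists U.C$, $\forall U.C$ if $U\in\Phi$. An interpretation $\mathcal I$ has a non-empty domain $\Delta^{\mathcal I}$, and satisfies $C(a)$ if $a^{\mathcal I}\in C^{\mathcal I}$. It is finitely branching if every object has finitely many $r$-successors for each role name $r$, and unreachable-objects-free if every object is reachable from some $a^{\mathcal I}$ along role edges. Write $y\le y'$ if every semi-positive concept true at $y$ is true at $y'$, and $y\equiv y'$ if $y\le y'\le y$. A *tidy reduct* of a finitely branching $\mathcal I$ (unreachable-objects-free if $U\in\Phi$) is obtained as follows, with $\le,\equiv$ taken in $\mathcal I$. For each role name $r$ and object $x$, delete edges one by one, until no deletion is possible: delete $(x,y')$ if $x$ still has an $r$-edge to some $y\ne y'$ with $y\equiv y'$ and $y'\neq x$; or if $x$ still has $r$-edges to some $y,y''$ with $y\le y'\le y''$, $y\not\equiv y'\not\equiv y''$, and ($\mathsf{Self}\notin\Phi$ or $y'\ne x$). Then restrict to the objects still reachable from some $a^{\mathcal I}$. An interpretation $\mathcal I$ is *tidy* if it is finitely branching, unreachable-objects-free and, for all $r$-successors $y,y',y''$ of an object $x$, with $\le,\equiv$ now taken in this interpretation: $y\equiv y'$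 implies $y=y'$; and $y\le y'\le y''$ implies $y=y'$ or $y'=y''$ or ($\mathsf{Self}\in\Phi$ and $y'=x$). An $\mathcal L_\Phi$-auto-bisimulation of $\mathcal I$ is a relation $Z$ on $\Delta^{\mathcal I}$ with $Z(a^{\mathcal I},a^{\mathcal I})$ for all $a\in\Sigma_I$, whose related objects belong to the same $A^{\mathcal I}$ ($A\in\Sigma_C$), and which satisfies the forth and back conditions for every role name; in addition, if $O\in\Phi$, $Z(x,x')$ implies $x=a^{\mathcal I}\Leftrightarrow x'=a^{\mathcal I}$; if $U\in\Phi$, $Z$ is total and surjective; if $\mathsf{Self}\in\Phi$, $Z(x,x')$ implies $r^{\mathcal I}(x,x)\Leftrightarrow r^{\mathcal I}(x',x')$. Let $\sim$ be the largest one, which is an equivalence relation. The quotient $\mathcal I/_\sim$ has as domain the $\sim$-classes, with $a\mapsto[a^{\mathcal I}]$, $A\mapsto\{[x]: x\in A^{\mathcal I}\}$ and $r\mapsto\{([x],[y]): r^{\mathcal I}(x,y)\}$. The QS-quotient $\mathcal I/^{QS}_\sim$ is $\mathcal I/_\sim$ together with the multiplicities $\mathrm{QU}(r)([x],[y])=\max_{x'\in[x]}\#\{y'\in[y]: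 r^{\mathcal I}(x',y')\}\in\mathbb N$ and the sets $\mathrm{SE}(r)=\{[x]: r^{\mathcal I}(x,x)\}$, and in it $\exists r.\mathsf{Self}$ is interpreted as $\mathrm{SE}(r)$. **Theorem.** Let $\mathcal I_0,\mathcal I_0'$ be finitely branching interpretations that satisfy the same assertions $C(a)$ with $C\in\mathcal L^{sp}_\Phi$, and that are unreachable-objects-free if $U\in\Phi$. Then $\mathcal I_0$ has a tidy reduct, and every tidy reduct $\mathcal I$ of $\mathcal I_0$ is tidy. Moreover, for every tidy reduct $\mathcal I$ of $\mathcal I_0$, put $\mathcal I_2=\mathcal I/_\sim$ if $\mathsf{Self}\notin\Phi$ and $\mathcal I_2=\mathcal I/^{QS}_\sim$ if $\mathsf{Self}\in\Phi$ (in the latter case all the maxima defining $\mathrm{QU}$ exist). Then $\mathcal I_2$ satisfies the same assertions of $\mathcal L^{sp}_\Phi$ as $\mathcal I_0'$, and $\#\Delta^{\mathcal I_2}\le\#\Delta^{\mathcal I_0'}$. -/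

import Mathlib

universe u v w₁ w₂ w₃

namespace DL

/-- The optional features: inverse roles, nominals, quantified number restrictions,
the universal role, local reflexivity. -/
inductive Feature where
  | I
  | O
  | Q
  | U
  | Self

/-- Basic roles of the language with features `Φ`: role names, and inverses of role names if
inverse roles are allowed. -/
inductive BasicRole (Φ : Set Feature) (RN : Type w₂) : Type w₂ where
  | atom (r : RN) : BasicRole Φ RN
  | inv (h : Feature.I ∈ Φ) (r : RN) : BasicRole Φ RN

/-! ### Syntax -/

mutual

/-- Roles of the description logic with features `Φ` over the given names. -/
inductive Role (Φ : Set Feature) (CN : Type w₁) (RN : Type w₂) (IN : Type w₃) :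
    Type (max w₁ w₂ w₃) where
  | atom (r : RN) : Role Φ CN RN IN
  | eps : Role Φ CN RN IN
  | comp (R S : Role Φ CN RN IN) : Role Φ CN RN IN
  | union (R S : Role Φ CN RN IN) : Role Φ CN RN IN
  | star (R : Role Φ CN RN IN) : Role Φ CN RN IN
  | test (C : Concept Φ CN RN IN) : Role Φ CN RN IN
  | inv (h : Feature.I ∈ Φ) (R : Role Φ CN RN IN) : Role Φ CN RN IN
  | univ (h : Feature.U ∈ Φ) : Role Φ CN RN IN

/-- Concepts of the description logic with features `Φ` over the given names. -/
inductive Concept (Φ : Set Feature) (CN : Type w₁) (RN : Type w₂) (IN : Type w₃) :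
    Type (max w₁ w₂ w₃) where
  | atom (A : CN) : Concept Φ CN RN IN
  | top : Concept Φ CN RN IN
  | bot : Concept Φ CN RN IN
  | neg (C : Concept Φ CN RN IN) : Concept Φ CN RN IN
  | or (C D : Concept Φ CN RN IN) : Concept Φ CN RN IN
  | and (C D : Concept Φ CN RN IN) : Concept Φ CN RN IN
  | ex (R : Role Φ CN RN IN) (C : Concept Φ CN RN IN) : Concept Φ CN RN IN
  | all (R : Role Φ CN RN IN) (C : Concept Φ CN RN IN) : Concept Φ CN RN IN
  | nominal (h : Feature.O ∈ Φ) (a : IN) : Concept Φ CN RN IN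
  | atLeast (h : Feature.Q ∈ Φ) (n : ℕ) (R : BasicRole Φ RN) (C : Concept Φ CN RN IN) :
      Concept Φ CN RN IN
  | atMost (h : Feature.Q ∈ Φ) (n : ℕ) (R : BasicRole Φ RN) (C : Concept Φ CN RN IN) :
      Concept Φ CN RN IN
  | exSelf (h : Feature.Self ∈ Φ) (r : RN) : Concept Φ CN RN IN

end

mutual

/-- Semi-positive concepts. -/
inductive SemiPos {Φ : Set Feature} {CN : Type w₁} {RN : Type w₂} {IN : Type w₃} :
    Concept Φ CN RN IN → Prop where
  | atom (A : CN) : SemiPos (.atom A)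
  | top : SemiPos .top
  | bot : SemiPos .bot
  | or {C D : Concept Φ CN RN IN} : SemiPos C → SemiPos D → SemiPos (.or C D)
  | and {C D : Concept Φ CN RN IN} : SemiPos C → SemiPos D → SemiPos (.and C D)
  | ex {R : Role Φ CN RN IN} {C : Concept Φ CN RN IN} :
      SemiPosE R → SemiPos C → SemiPos (.ex R C)
  | all {S : Role Φ CN RN IN} {C : Concept Φ CN RN IN} :
      SemiPosA S → SemiPos C → SemiPos (.all S C)
  | nominal (h : Feature.O ∈ Φ) (a : IN) : SemiPos (.nominal h a)
  | exSelf (h : Feature.Self ∈ Φ) (r : RN) : SemiPos (.exSelf h r)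
  | atLeast (h : Feature.Q ∈ Φ) (n : ℕ) (R : BasicRole Φ RN) {C : Concept Φ CN RN IN} :
      SemiPos C → SemiPos (.atLeast h n R C)
  | atMost (h : Feature.Q ∈ Φ) (n : ℕ) (R : BasicRole Φ RN) {C : Concept Φ CN RN IN} :
      SemiPos C → SemiPos (.atMost h n R (.neg C))
  | exUniv (h : Feature.U ∈ Φ) {C : Concept Φ CN RN IN} :
      SemiPos C → SemiPos (.ex (.univ h) C)
  | allUniv (h : Feature.U ∈ Φ) {C : Concept Φ CN RN IN} :
      SemiPos C → SemiPos (.all (.univ h) C)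

/-- Roles that may stand under an existential restriction in a semi-positive concept. -/
inductive SemiPosE {Φ : Set Feature} {CN : Type w₁} {RN : Type w₂} {IN : Type w₃} :
    Role Φ CN RN IN → Prop where
  | atom (r : RN) : SemiPosE (.atom r)
  | inv (h : Feature.I ∈ Φ) (r : RN) : SemiPosE (.inv h (.atom r))
  | eps : SemiPosE .eps
  | comp {R S : Role Φ CN RN IN} : SemiPosE R → SemiPosE S → SemiPosE (.comp R S)
  | union {R S : Role Φ CN RN IN} : SemiPosE R → SemiPosE S → SemiPosE (.union R S)
  | star {R : Role Φ CN RN IN} : SemiPosE R → SemiPosE (.star R)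
  | test {C : Concept Φ CN RN IN} : SemiPos C → SemiPosE (.test C)

/-- Roles that may stand under a universal restriction in a semi-positive concept. -/
inductive SemiPosA {Φ : Set Feature} {CN : Type w₁} {RN : Type w₂} {IN : Type w₃} :
    Role Φ CN RN IN → Prop where
  | atom (r : RN) : SemiPosA (.atom r)
  | inv (h : Feature.I ∈ Φ) (r : RN) : SemiPosA (.inv h (.atom r))
  | eps : SemiPosA .eps
  | comp {R S : Role Φ CN RN IN} : SemiPosA R → SemiPosA S → SemiPosA (.comp R S)
  | union {R S : Role Φ CN RN IN} : SemiPosA R → SemiPosA S → SemiPosA (.union R S)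
  | star {R : Role Φ CN RN IN} : SemiPosA R → SemiPosA (.star R)
  | test {C : Concept Φ CN RN IN} : SemiPos C → SemiPosA (.test (.neg C))

end

/-! ### Interpretations -/

/-- An interpretation with a non-empty domain. -/
structure Interp (CN : Type w₁) (RN : Type w₂) (IN : Type w₃) where
  Dom : Type u
  nonempty : Nonempty Dom
  concept : CN → Set Dom
  role : RN → Dom → Dom → Prop
  ind : IN → Dom

variable {CN : Type w₁} {RN : Type w₂} {IN : Type w₃} {Φ : Set Feature}

/-- The binary relation denoted by a basic role. -/
def Interp.basic (M : Interp.{u} CN RN IN) : BasicRole Φ RN → M.Dom → M.Dom → Prop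
  | .atom r => fun x y => M.role r x y
  | .inv _ r => fun x y => M.role r y x

mutual

/-- Extension of roles, where `slf r` is the extension of the concept `∃ r.Self`, and `cnt R x S`
is the number of `R`-successors of `x` in `S`. -/
def roleEval (M : Interp.{u} CN RN IN) (slf : RN → Set M.Dom)
    (cnt : BasicRole Φ RN → M.Dom → Set M.Dom → Cardinal.{u}) :
    Role Φ CN RN IN → M.Dom → M.Dom → Prop
  | .atom r => fun x y => M.role r x y
  | .eps => fun x y => x = y
  | .comp R S => fun x y => ∃ z, roleEval M slf cnt R x z ∧ roleEval M slf cnt S z y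
  | .union R S => fun x y => roleEval M slf cnt R x y ∨ roleEval M slf cnt S x y
  | .star R => Relation.ReflTransGen (roleEval M slf cnt R)
  | .test C => fun x y => x = y ∧ x ∈ conceptEval M slf cnt C
  | .inv _ R => fun x y => roleEval M slf cnt R y x
  | .univ _ => fun _ _ => True

/-- Extension of concepts, with the same parameters. -/
def conceptEval (M : Interp.{u} CN RN IN) (slf : RN → Set M.Dom)
    (cnt : BasicRole Φ RN → M.Dom → Set M.Dom → Cardinal.{u}) :
    Concept Φ CN RN IN → Set M.Dom
  | .atom A => M.concept A
  | .top => Set.univ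
  | .bot => ∅
  | .neg C => (conceptEval M slf cnt C)ᶜ
  | .or C D => conceptEval M slf cnt C ∪ conceptEval M slf cnt D
  | .and C D => conceptEval M slf cnt C ∩ conceptEval M slf cnt D
  | .ex R C => {x | ∃ y, roleEval M slf cnt R x y ∧ y ∈ conceptEval M slf cnt C}
  | .all R C => {x | ∀ y, roleEval M slf cnt R x y → y ∈ conceptEval M slf cnt C}
  | .nominal _ a => {M.ind a}
  | .atLeast _ n R C => {x | (n : Cardinal.{u}) ≤ cnt R x (conceptEval M slf cnt C)}
  | .atMost _ n R C => {x | cnt R x (conceptEval M slf cnt C) ≤ (n : Cardinal.{u})}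
  | .exSelf _ r => slf r

end

/-- The extension of a concept in an interpretation. -/
def Interp.ext (M : Interp.{u} CN RN IN) (C : Concept Φ CN RN IN) : Set M.Dom :=
  conceptEval M (fun r => {x | M.role r x x})
    (fun R x S => Cardinal.mk {y : M.Dom // M.basic R x y ∧ y ∈ S}) C

/-- `M` satisfies the concept assertion `C(a)`. -/
def Interp.Satisfies (M : Interp.{u} CN RN IN) (C : Concept Φ CN RN IN) (a : IN) : Prop :=
  M.ind a ∈ M.ext C

/-- A QS-interpretation: an interpretation with multiplicities `QU` of basic roles and with sets
`SE r` of objects that are regarded as `r`-reflexive. -/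
structure QSInterp (Φ : Set Feature) (CN : Type w₁) (RN : Type w₂) (IN : Type w₃) extends
    Interp.{u} CN RN IN where
  QU : BasicRole Φ RN → Dom → Dom → ℕ
  QU_pos_iff : ∀ (R : BasicRole Φ RN) (x y : Dom), 0 < QU R x y ↔ toInterp.basic R x y
  SE : RN → Set Dom

/-- The extension of a concept in a QS-interpretation. -/
def QSInterp.ext (M : QSInterp.{u} Φ CN RN IN) (C : Concept Φ CN RN IN) : Set M.Dom :=
  conceptEval M.toInterp M.SE
    (fun R x S => Cardinal.sum fun y : {y : M.Dom // y ∈ S} => (M.QU R x y : Cardinal.{u})) C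

/-- The QS-interpretation `M` satisfies the concept assertion `C(a)`. -/
def QSInterp.Satisfies (M : QSInterp.{u} Φ CN RN IN) (C : Concept Φ CN RN IN) (a : IN) : Prop :=
  M.ind a ∈ M.ext C

/-- `x` is less than or equal to `y` w.r.t. semi-positive concepts. -/
def SpLe (Φ : Set Feature) (M : Interp.{u} CN RN IN) (x : M.Dom)
    (N : Interp.{v} CN RN IN) (y : N.Dom) : Prop :=
  ∀ C : Concept Φ CN RN IN, SemiPos C → x ∈ M.ext C → y ∈ N.ext C

/-- `x` is equivalent to `y` w.r.t. semi-positive concepts. -/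
def SpEquiv (Φ : Set Feature) (M : Interp.{u} CN RN IN) (x : M.Dom)
    (N : Interp.{v} CN RN IN) (y : N.Dom) : Prop :=
  SpLe Φ M x N y ∧ SpLe Φ N y M x

/-- Finitely branching interpretations. -/
def FinitelyBranching (Φ : Set Feature) (M : Interp.{u} CN RN IN) : Prop :=
  ∀ (x : M.Dom) (R : BasicRole Φ RN), {y | M.basic R x y}.Finite

/-- `y` is reachable from a named object along edges of basic roles. -/
def Reachable (Φ : Set Feature) (M : Interp.{u} CN RN IN) (y : M.Dom) : Prop :=
  ∃ a : IN, Relation.ReflTransGen (fun x z => ∃ R : BasicRole Φ RN, M.basic R x z) (M.ind a) y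

/-- Unreachable-objects-free interpretations. -/
def UnreachableObjectsFree (Φ : Set Feature) (M : Interp.{u} CN RN IN) : Prop :=
  ∀ y : M.Dom, Reachable Φ M y

/-! ### Bisimulations and the quotient by the largest auto-bisimulation -/

/-- Bisimulations between two interpretations. -/
structure IsBisimulation (Φ : Set Feature) (M : Interp.{u} CN RN IN) (N : Interp.{v} CN RN IN)
    (Z : M.Dom → N.Dom → Prop) : Prop where
  ind : ∀ a, Z (M.ind a) (N.ind a)
  concept : ∀ A x x', Z x x' → (x ∈ M.concept A ↔ x' ∈ N.concept A)
  forth : ∀ r x y x', Z x x' → M.role r x y → ∃ y', Z y y' ∧ N.role r x' y'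
  back : ∀ r x x' y', Z x x' → N.role r x' y' → ∃ y, Z y y' ∧ M.role r x y
  inv_forth : Feature.I ∈ Φ → ∀ r x y x', Z x x' → M.role r y x → ∃ y', Z y y' ∧ N.role r y' x'
  inv_back : Feature.I ∈ Φ → ∀ r x x' y', Z x x' → N.role r y' x' → ∃ y, Z y y' ∧ M.role r y x
  nominal : Feature.O ∈ Φ → ∀ a x x', Z x x' → (x = M.ind a ↔ x' = N.ind a)
  num : Feature.Q ∈ Φ → ∀ r x x', Z x x' →
    ∃ h : {y // M.role r x y} ≃ {y' // N.role r x' y'}, ∀ y : {y // M.role r x y}, Z y (h y)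
  num_inv : Feature.Q ∈ Φ → Feature.I ∈ Φ → ∀ r x x', Z x x' →
    ∃ h : {y // M.role r y x} ≃ {y' // N.role r y' x'}, ∀ y : {y // M.role r y x}, Z y (h y)
  univ_forth : Feature.U ∈ Φ → ∀ x, ∃ x', Z x x'
  univ_back : Feature.U ∈ Φ → ∀ x', ∃ x, Z x x'
  exSelf : Feature.Self ∈ Φ → ∀ r x x', Z x x' → (M.role r x x ↔ N.role r x' x')

/-- The largest auto-bisimulation of `M`, as the union of all auto-bisimulations. -/
def Sim (Φ : Set Feature) (M : Interp.{u} CN RN IN) (x y : M.Dom) : Prop :=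
  ∃ Z : M.Dom → M.Dom → Prop, IsBisimulation Φ M M Z ∧ Z x y

theorem IsBisimulation.refl (Φ : Set Feature) (M : Interp.{u} CN RN IN) :
    IsBisimulation Φ M M (fun x y => x = y) where
  ind _ := rfl
  concept := by rintro A x _ rfl; rfl
  forth := by rintro r x y _ rfl h; exact ⟨y, rfl, h⟩
  back := by rintro r x _ y rfl h; exact ⟨y, rfl, h⟩
  inv_forth := by rintro _ r x y _ rfl h; exact ⟨y, rfl, h⟩
  inv_back := by rintro _ r x _ y rfl h; exact ⟨y, rfl, h⟩
  nominal := by rintro _ a x _ rfl; rfl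
  num := by rintro _ r x _ rfl; exact ⟨Equiv.refl _, fun _ => rfl⟩
  num_inv := by rintro _ _ r x _ rfl; exact ⟨Equiv.refl _, fun _ => rfl⟩
  univ_forth := fun _ x => ⟨x, rfl⟩
  univ_back := fun _ x => ⟨x, rfl⟩
  exSelf := by rintro _ r x _ rfl; rfl

theorem IsBisimulation.symm {M : Interp.{u} CN RN IN} {N : Interp.{v} CN RN IN}
    {Z : M.Dom → N.Dom → Prop} (h : IsBisimulation Φ M N Z) :
    IsBisimulation Φ N M (fun x y => Z y x) where
  ind := h.ind
  concept := fun A x x' hz => (h.concept A x' x hz).symm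
  forth := fun r x y x' hz hr => h.back r x' x y hz hr
  back := fun r x x' y' hz hr => h.forth r x' y' x hz hr
  inv_forth := fun hI r x y x' hz hr => h.inv_back hI r x' x y hz hr
  inv_back := fun hI r x x' y' hz hr => h.inv_forth hI r x' y' x hz hr
  nominal := fun hO a x x' hz => (h.nominal hO a x' x hz).symm
  num := fun hQ r x x' hz => by
    obtain ⟨e, he⟩ := h.num hQ r x' x hz
    exact ⟨e.symm, fun y => by simpa using he (e.symm y)⟩
  num_inv := fun hQ hI r x x' hz => by
    obtain ⟨e, he⟩ := h.num_inv hQ hI r x' x hz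
    exact ⟨e.symm, fun y => by simpa using he (e.symm y)⟩
  univ_forth := h.univ_back
  univ_back := h.univ_forth
  exSelf := fun hS r x x' hz => (h.exSelf hS r x' x hz).symm

theorem IsBisimulation.comp {M N K : Interp.{u} CN RN IN}
    {Z : M.Dom → N.Dom → Prop} {W : N.Dom → K.Dom → Prop}
    (h : IsBisimulation Φ M N Z) (k : IsBisimulation Φ N K W) :
    IsBisimulation Φ M K (fun x z => ∃ y, Z x y ∧ W y z) where
  ind a := ⟨_, h.ind a, k.ind a⟩
  concept := by
    rintro A x z ⟨y, hz, hw⟩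
    exact (h.concept A x y hz).trans (k.concept A y z hw)
  forth := by
    rintro r x x₁ z ⟨y, hz, hw⟩ hr
    obtain ⟨y₁, hz₁, hr₁⟩ := h.forth r x x₁ y hz hr
    obtain ⟨z₁, hw₁, hr₂⟩ := k.forth r y y₁ z hw hr₁
    exact ⟨z₁, ⟨y₁, hz₁, hw₁⟩, hr₂⟩
  back := by
    rintro r x z z₁ ⟨y, hz, hw⟩ hr
    obtain ⟨y₁, hw₁, hr₁⟩ := k.back r y z z₁ hw hr
    obtain ⟨x₁, hz₁, hr₂⟩ := h.back r x y y₁ hz hr₁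
    exact ⟨x₁, ⟨y₁, hz₁, hw₁⟩, hr₂⟩
  inv_forth := by
    rintro hI r x x₁ z ⟨y, hz, hw⟩ hr
    obtain ⟨y₁, hz₁, hr₁⟩ := h.inv_forth hI r x x₁ y hz hr
    obtain ⟨z₁, hw₁, hr₂⟩ := k.inv_forth hI r y y₁ z hw hr₁
    exact ⟨z₁, ⟨y₁, hz₁, hw₁⟩, hr₂⟩
  inv_back := by
    rintro hI r x z z₁ ⟨y, hz, hw⟩ hr
    obtain ⟨y₁, hw₁, hr₁⟩ := k.inv_back hI r y z z₁ hw hr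
    obtain ⟨x₁, hz₁, hr₂⟩ := h.inv_back hI r x y y₁ hz hr₁
    exact ⟨x₁, ⟨y₁, hz₁, hw₁⟩, hr₂⟩
  nominal := by
    rintro hO a x z ⟨y, hz, hw⟩
    exact (h.nominal hO a x y hz).trans (k.nominal hO a y z hw)
  num := by
    rintro hQ r x z ⟨y, hz, hw⟩
    obtain ⟨e, he⟩ := h.num hQ r x y hz
    obtain ⟨f, hf⟩ := k.num hQ r y z hw
    exact ⟨e.trans f, fun t => ⟨e t, he t, hf (e t)⟩⟩
  num_inv := by
    rintro hQ hI r x z ⟨y, hz, hw⟩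
    obtain ⟨e, he⟩ := h.num_inv hQ hI r x y hz
    obtain ⟨f, hf⟩ := k.num_inv hQ hI r y z hw
    exact ⟨e.trans f, fun t => ⟨e t, he t, hf (e t)⟩⟩
  univ_forth := fun hU x => by
    obtain ⟨y, hy⟩ := h.univ_forth hU x
    obtain ⟨z, hz⟩ := k.univ_forth hU y
    exact ⟨z, y, hy, hz⟩
  univ_back := fun hU z => by
    obtain ⟨y, hy⟩ := k.univ_back hU z
    obtain ⟨x, hx⟩ := h.univ_back hU y
    exact ⟨x, y, hx, hy⟩
  exSelf := by
    rintro hS r x z ⟨y, hz, hw⟩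
    exact (h.exSelf hS r x y hz).trans (k.exSelf hS r y z hw)

/-- `Sim Φ M` is itself an auto-bisimulation; by its definition it contains all others. -/
theorem Sim.isBisimulation (Φ : Set Feature) (M : Interp.{u} CN RN IN) :
    IsBisimulation Φ M M (Sim Φ M) where
  ind _ := ⟨_, .refl Φ M, rfl⟩
  concept := fun A x x' ⟨_, h, hz⟩ => h.concept A x x' hz
  forth := fun r x y x' ⟨Z, h, hz⟩ hr =>
    let ⟨y', hy, hr'⟩ := h.forth r x y x' hz hr
    ⟨y', ⟨Z, h, hy⟩, hr'⟩
  back := fun r x x' y' ⟨Z, h, hz⟩ hr =>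
    let ⟨y, hy, hr'⟩ := h.back r x x' y' hz hr
    ⟨y, ⟨Z, h, hy⟩, hr'⟩
  inv_forth := fun hI r x y x' ⟨Z, h, hz⟩ hr =>
    let ⟨y', hy, hr'⟩ := h.inv_forth hI r x y x' hz hr
    ⟨y', ⟨Z, h, hy⟩, hr'⟩
  inv_back := fun hI r x x' y' ⟨Z, h, hz⟩ hr =>
    let ⟨y, hy, hr'⟩ := h.inv_back hI r x x' y' hz hr
    ⟨y, ⟨Z, h, hy⟩, hr'⟩
  nominal := fun hO a x x' ⟨_, h, hz⟩ => h.nominal hO a x x' hz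
  num := fun hQ r x x' ⟨Z, h, hz⟩ =>
    let ⟨e, he⟩ := h.num hQ r x x' hz
    ⟨e, fun y => ⟨Z, h, he y⟩⟩
  num_inv := fun hQ hI r x x' ⟨Z, h, hz⟩ =>
    let ⟨e, he⟩ := h.num_inv hQ hI r x x' hz
    ⟨e, fun y => ⟨Z, h, he y⟩⟩
  univ_forth := fun _ x => ⟨x, _, .refl Φ M, rfl⟩
  univ_back := fun _ x => ⟨x, _, .refl Φ M, rfl⟩
  exSelf := fun hS r x x' ⟨_, h, hz⟩ => h.exSelf hS r x x' hz

theorem Sim.equivalence (Φ : Set Feature) (M : Interp.{u} CN RN IN) :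
    Equivalence (Sim Φ M) where
  refl _ := ⟨_, .refl Φ M, rfl⟩
  symm := fun ⟨_, h, hz⟩ => ⟨_, h.symm, hz⟩
  trans := fun {_ y _} ⟨_, h, hz⟩ ⟨_, k, hw⟩ => ⟨_, h.comp k, y, hz, hw⟩

/-- The largest auto-bisimulation as an equivalence relation. -/
def simSetoid (Φ : Set Feature) (M : Interp.{u} CN RN IN) : Setoid M.Dom :=
  ⟨Sim Φ M, Sim.equivalence Φ M⟩

/-- The class of `x` w.r.t. the largest auto-bisimulation. -/
def simClass (Φ : Set Feature) (M : Interp.{u} CN RN IN) (x : M.Dom) :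
    Quotient (simSetoid Φ M) :=
  Quotient.mk (simSetoid Φ M) x

/-- The quotient interpretation w.r.t. the largest auto-bisimulation. -/
def quot (Φ : Set Feature) (M : Interp.{u} CN RN IN) : Interp.{u} CN RN IN where
  Dom := Quotient (simSetoid Φ M)
  nonempty := M.nonempty.map (simClass Φ M)
  concept A := {q | ∃ x, simClass Φ M x = q ∧ x ∈ M.concept A}
  role r p q := ∃ x y, simClass Φ M x = p ∧ simClass Φ M y = q ∧ M.role r x y
  ind a := simClass Φ M (M.ind a)

/-- The `R`-successors of `x` in the class `q`. -/
def succIn (Φ : Set Feature) (M : Interp.{u} CN RN IN) (R : BasicRole Φ RN) (x : M.Dom)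
    (q : Quotient (simSetoid Φ M)) : Set M.Dom :=
  {y | simClass Φ M y = q ∧ M.basic R x y}

/-- All the maxima used in the quotient QS-interpretation exist as natural numbers. -/
def HasQuotQS (Φ : Set Feature) (M : Interp.{u} CN RN IN) : Prop :=
  ∀ (R : BasicRole Φ RN) (p q : Quotient (simSetoid Φ M)),
    ∃ n : ℕ, ∀ x, simClass Φ M x = p → (succIn Φ M R x q).encard ≤ n

/-- The maximum, over the elements `x` of the class `p`, of the number of `R`-successors of `x` in
the class `q`. -/
noncomputable def maxSucc (Φ : Set Feature) (M : Interp.{u} CN RN IN) (R : BasicRole Φ RN)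
    (p q : Quotient (simSetoid Φ M)) : ℕ :=
  sSup {n | ∃ x, simClass Φ M x = p ∧ n = (succIn Φ M R x q).ncard}

theorem maxSucc_pos_iff {M : Interp.{u} CN RN IN} (h : HasQuotQS Φ M) (R : BasicRole Φ RN)
    (p q : Quotient (simSetoid Φ M)) :
    0 < maxSucc Φ M R p q ↔ (quot Φ M).basic R p q := by
  obtain ⟨n, hn⟩ := h R p q
  have hfin : ∀ x, simClass Φ M x = p → (succIn Φ M R x q).Finite := fun x hx =>
    Set.finite_of_encard_le_coe (hn x hx)
  have hbdd : BddAbove {m | ∃ x, simClass Φ M x = p ∧ m = (succIn Φ M R x q).ncard} := by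
    refine ⟨n, ?_⟩
    rintro _ ⟨x, hx, rfl⟩
    have h1 := hn x hx
    rw [← (hfin x hx).cast_ncard_eq] at h1
    exact_mod_cast h1
  have key : 0 < maxSucc Φ M R p q ↔ ∃ x y, simClass Φ M x = p ∧ simClass Φ M y = q ∧
      M.basic R x y := by
    constructor
    · intro hp
      have hne : {m | ∃ x, simClass Φ M x = p ∧ m = (succIn Φ M R x q).ncard}.Nonempty := by
        obtain ⟨x, hx⟩ := Quotient.exists_rep p
        exact ⟨_, x, hx, rfl⟩
      obtain ⟨x, hx, he⟩ := Nat.sSup_mem hne hbdd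
      have hp' : 0 < (succIn Φ M R x q).ncard := he ▸ hp
      obtain ⟨y, hy, hR⟩ := (Set.ncard_pos (hfin x hx)).1 hp'
      exact ⟨x, y, hx, hy, hR⟩
    · rintro ⟨x, y, hx, hy, hR⟩
      have h1 : 0 < (succIn Φ M R x q).ncard := (Set.ncard_pos (hfin x hx)).2 ⟨y, hy, hR⟩
      exact h1.trans_le (le_csSup hbdd ⟨x, hx, rfl⟩)
  rw [key]
  cases R with
  | atom r => rfl
  | inv hI r =>
    constructor
    · rintro ⟨x, y, hx, hy, hR⟩
      exact ⟨y, x, hy, hx, hR⟩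
    · rintro ⟨y, x, hy, hx, hR⟩
      exact ⟨x, y, hx, hy, hR⟩

/-- The quotient QS-interpretation w.r.t. the largest auto-bisimulation. -/
noncomputable def quotQS (Φ : Set Feature) (M : Interp.{u} CN RN IN) (h : HasQuotQS Φ M) :
    QSInterp.{u} Φ CN RN IN where
  toInterp := quot Φ M
  QU := maxSucc Φ M
  QU_pos_iff := maxSucc_pos_iff h
  SE r := {q | ∃ x, simClass Φ M x = q ∧ M.role r x x}

/-! ### Tidy interpretations and tidy reducts -/

/-- Tidy (finitely branching) interpretations. -/
structure IsTidy (Φ : Set Feature) (M : Interp.{u} CN RN IN) : Prop where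
  finitelyBranching : FinitelyBranching Φ M
  unreachableObjectsFree : UnreachableObjectsFree Φ M
  eq_of_equiv : ∀ (R : BasicRole Φ RN) (x y y' : M.Dom), M.basic R x y → M.basic R x y' →
    SpEquiv Φ M y M y' → y = y'
  eq_of_le_of_le : ∀ (R : BasicRole Φ RN) (x y y' y'' : M.Dom),
    M.basic R x y → M.basic R x y' → M.basic R x y'' →
    SpLe Φ M y M y' → SpLe Φ M y' M y'' →
    y = y' ∨ y' = y'' ∨ (Feature.Self ∈ Φ ∧ y' = x)

/-- One deletion step: `T` results from the set `S` of current successors of `x` (w.r.t. some role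
name) by deleting the edge from `x` to one superfluous successor `y'`. -/
inductive TidyStep (Φ : Set Feature) (M : Interp.{u} CN RN IN) (x : M.Dom) (S : Set M.Dom) :
    Set M.Dom → Prop where
  | equiv (y y' : M.Dom) : y ∈ S → y' ∈ S → SpEquiv Φ M y M y' → y ≠ y' → y' ≠ x →
      TidyStep Φ M x S (S \ {y'})
  | between (y y' y'' : M.Dom) : y ∈ S → y' ∈ S → y'' ∈ S →
      SpLe Φ M y M y' → SpLe Φ M y' M y'' → ¬ SpEquiv Φ M y M y' → ¬ SpEquiv Φ M y' M y'' →
      (Feature.Self ∉ Φ ∨ y' ≠ x) → TidyStep Φ M x S (S \ {y'})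

/-- The relations `E r` result from the relations `M.role r` by deleting superfluous edges one by
one until no edge can be deleted any more. -/
def IsPruning (Φ : Set Feature) (M : Interp.{u} CN RN IN) (E : RN → M.Dom → M.Dom → Prop) :
    Prop :=
  ∀ (r : RN) (x : M.Dom),
    Relation.ReflTransGen (TidyStep Φ M x) {y | M.role r x y} {y | E r x y} ∧
    ∀ T, ¬ TidyStep Φ M x {y | E r x y} T

/-- The interpretation `M` with its role names reinterpreted. -/
def Interp.withRoles (M : Interp.{u} CN RN IN) (E : RN → M.Dom → M.Dom → Prop) :
    Interp.{u} CN RN IN :=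
  { M with role := E }

/-- The restriction of `M` to the objects that are reachable from named objects. -/
def reachablePart [Nonempty IN] (Φ : Set Feature) (M : Interp.{u} CN RN IN) :
    Interp.{u} CN RN IN where
  Dom := {x : M.Dom // Reachable Φ M x}
  nonempty := ‹Nonempty IN›.map fun a => ⟨M.ind a, a, .refl⟩
  concept A := {x | x.1 ∈ M.concept A}
  role r x y := M.role r x.1 y.1
  ind a := ⟨M.ind a, a, .refl⟩

/-- `J` is a tidy reduct of `M`: superfluous edges are deleted exhaustively, and then the objects
that are no longer reachable are deleted. -/
def IsTidyReduct [Nonempty IN] (Φ : Set Feature) (M J : Interp.{u} CN RN IN) : Prop :=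
  ∃ E : RN → M.Dom → M.Dom → Prop, IsPruning Φ M E ∧ J = reachablePart Φ (M.withRoles E)

end DL

/-!
Write `x ≤ y` when every semi-positive concept true at `x` is true at `y`, and `x ≡ y` when
`x ≤ y ≤ x`.

Without inverse roles and number restrictions, semi-positive concepts are preserved
by *comparisons*, i.e. relations which satisfy the back and forth conditions of a
bisimulation but preserve concept names, nominals and loops in one direction only
(`IsComparison.concept_mono`). Conversely, `≤` satisfies the back and forth conditions between
finitely branching interpretations (`SpLe.forth`, `SpLe.back`), and paths from named objects
make it total and surjective as needed for the universal role.

*The reduct.* Each deletion of an edge from `x` to `y'` leaves edges from `x` to some `y₁` and `y₂`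
with `y₁ ≤ y' ≤ y₂`, so the remaining edges bound every original edge from both sides
(`IsPruning.exists_le`, `IsPruning.exists_ge`). Hence `≤` is a comparison in both directions
between an interpretation and its tidy reduct, every object of the reduct keeps its semi-positive
theory (`IsPruning.reachablePart_spEquiv`), and exhaustiveness of the
deletions gives tidiness (`IsPruning.isTidy`).

*Minimality.* Let `x` be an object of a tidy interpretation, `x ≡ x'`, and `y` an `r`-successor of
`x`. Going to `x'` and back, one finds successors `y₁, y₂` of `x` and `y', y''` of `x'` with
`y₁ ≤ y' ≤ y ≤ y'' ≤ y₂`. Tidiness forces `y₁ = y` or `y = y₂`, unless `y = x` is a loop that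
`∃ r.Self` transfers to `x'`; in all cases `y` is equivalent to an `r`-successor of `x'`
(`IsTidy.exists_equiv_succ`). Two conclusions follow. Within the tidy interpretation, `≡` is an
auto-bisimulation, so it is the relation `∼` of the quotient. And by induction along paths, every
object of the reduct is equivalent to some object of the other interpretation, so that sending
classes to such objects is injective. Finally, `∼`-related successors of one object are equivalent,
hence equal, so the multiplicities of the quotient are at most one.
-/

universe w

namespace DL

variable {CN : Type w₁} {RN : Type w₂} {IN : Type w₃} {Φ : Set Feature}

/-! ### Comparisons preserve semi-positive concepts -/

/-- Comparisons: the directed version of bisimulations, preserving concept names, nominals and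
local reflexivity from left to right only. The extensions `slf`, `slf'` of the concepts
`∃ r.Self` are parameters, so that QS-interpretations are covered. -/
structure IsComparison (Φ : Set Feature) (M : Interp.{u} CN RN IN) (slf : RN → Set M.Dom)
    (N : Interp.{v} CN RN IN) (slf' : RN → Set N.Dom) (Z : M.Dom → N.Dom → Prop) : Prop where
  concept : ∀ A x x', Z x x' → x ∈ M.concept A → x' ∈ N.concept A
  forth : ∀ r x y x', Z x x' → M.role r x y → ∃ y', N.role r x' y' ∧ Z y y'
  back : ∀ r x x' y', Z x x' → N.role r x' y' → ∃ y, M.role r x y ∧ Z y y'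
  nominal : Feature.O ∈ Φ → ∀ a x', Z (M.ind a) x' → x' = N.ind a
  univ_forth : Feature.U ∈ Φ → ∀ x, ∃ x', Z x x'
  univ_back : Feature.U ∈ Φ → ∀ x', ∃ x, Z x x'
  exSelf : Feature.Self ∈ Φ → ∀ r x x', Z x x' → x ∈ slf r → x' ∈ slf' r

section Preservation

variable {M : Interp.{u} CN RN IN} {slf : RN → Set M.Dom} {N : Interp.{v} CN RN IN}
  {slf' : RN → Set N.Dom} {Z : M.Dom → N.Dom → Prop}

mutual

/-- Comparisons preserve semi-positive concepts; the counting parameters are irrelevant in the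
absence of number restrictions. -/
theorem IsComparison.concept_mono (hZ : IsComparison Φ M slf N slf' Z)
    (hI : Feature.I ∉ Φ) (hQ : Feature.Q ∉ Φ)
    (cnt : BasicRole Φ RN → M.Dom → Set M.Dom → Cardinal.{u})
    (cnt' : BasicRole Φ RN → N.Dom → Set N.Dom → Cardinal.{v})
    {C : Concept Φ CN RN IN} (hC : SemiPos C) (x : M.Dom) (x' : N.Dom) (hz : Z x x')
    (hx : x ∈ conceptEval M slf cnt C) : x' ∈ conceptEval N slf' cnt' C := by
  cases hC with
  | atom A => exact hZ.concept A x x' hz hx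
  | top => trivial
  | bot => exact hx.elim
  | or hC hD =>
    exact hx.imp (IsComparison.concept_mono hZ hI hQ cnt cnt' hC x x' hz)
      (IsComparison.concept_mono hZ hI hQ cnt cnt' hD x x' hz)
  | and hC hD =>
    exact ⟨IsComparison.concept_mono hZ hI hQ cnt cnt' hC x x' hz hx.1,
      IsComparison.concept_mono hZ hI hQ cnt cnt' hD x x' hz hx.2⟩
  | ex hR hC =>
    obtain ⟨y, hy, hyC⟩ := hx
    obtain ⟨y', hy', hz'⟩ := IsComparison.role_forth hZ hI hQ cnt cnt' hR x y x' hz hy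
    exact ⟨y', hy', IsComparison.concept_mono hZ hI hQ cnt cnt' hC y y' hz' hyC⟩
  | all hS hC =>
    intro y' hy'
    obtain ⟨y, hy, hz'⟩ := IsComparison.role_back hZ hI hQ cnt cnt' hS x x' y' hz hy'
    exact IsComparison.concept_mono hZ hI hQ cnt cnt' hC y y' hz' (hx y hy)
  | nominal h a =>
    obtain rfl : x = M.ind a := hx
    exact hZ.nominal h a x' hz
  | exSelf h r => exact hZ.exSelf h r x x' hz hx
  | atLeast h => exact absurd h hQ
  | atMost h => exact absurd h hQ
  | exUniv h hC =>
    obtain ⟨y, -, hyC⟩ := hx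
    obtain ⟨y', hz'⟩ := hZ.univ_forth h y
    exact ⟨y', trivial, IsComparison.concept_mono hZ hI hQ cnt cnt' hC y y' hz' hyC⟩
  | allUniv h hC =>
    intro y' _
    obtain ⟨y, hz'⟩ := hZ.univ_back h y'
    exact IsComparison.concept_mono hZ hI hQ cnt cnt' hC y y' hz' (hx y trivial)

/-- The forth condition extends from role names to all roles that are allowed under `∃`. -/
theorem IsComparison.role_forth (hZ : IsComparison Φ M slf N slf' Z)
    (hI : Feature.I ∉ Φ) (hQ : Feature.Q ∉ Φ)
    (cnt : BasicRole Φ RN → M.Dom → Set M.Dom → Cardinal.{u})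
    (cnt' : BasicRole Φ RN → N.Dom → Set N.Dom → Cardinal.{v})
    {R : Role Φ CN RN IN} (hR : SemiPosE R) (x y : M.Dom) (x' : N.Dom) (hz : Z x x')
    (hxy : roleEval M slf cnt R x y) : ∃ y', roleEval N slf' cnt' R x' y' ∧ Z y y' := by
  cases hR with
  | atom r => exact hZ.forth r x y x' hz hxy
  | inv h => exact absurd h hI
  | eps =>
    obtain rfl : x = y := hxy
    exact ⟨x', rfl, hz⟩
  | comp hR hS =>
    obtain ⟨w, hw, hwy⟩ := hxy
    obtain ⟨w', hw', hzw⟩ := IsComparison.role_forth hZ hI hQ cnt cnt' hR x w x' hz hw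
    obtain ⟨y', hy', hzy⟩ := IsComparison.role_forth hZ hI hQ cnt cnt' hS w y w' hzw hwy
    exact ⟨y', ⟨w', hw', hy'⟩, hzy⟩
  | union hR hS =>
    rcases hxy with h | h
    · obtain ⟨y', hy', hzy⟩ := IsComparison.role_forth hZ hI hQ cnt cnt' hR x y x' hz h
      exact ⟨y', Or.inl hy', hzy⟩
    · obtain ⟨y', hy', hzy⟩ := IsComparison.role_forth hZ hI hQ cnt cnt' hS x y x' hz h
      exact ⟨y', Or.inr hy', hzy⟩
  | star hR =>
    have key := IsComparison.role_forth hZ hI hQ cnt cnt' hR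
    change Relation.ReflTransGen _ x y at hxy
    change ∃ y', Relation.ReflTransGen _ x' y' ∧ Z y y'
    induction hxy with
    | refl => exact ⟨x', .refl, hz⟩
    | tail _ h ih =>
      obtain ⟨w', hw', hzw⟩ := ih
      obtain ⟨y', hy', hzy⟩ := key _ _ _ hzw h
      exact ⟨y', hw'.tail hy', hzy⟩
  | test hC =>
    obtain ⟨rfl, hx⟩ := hxy
    exact ⟨x', ⟨rfl, IsComparison.concept_mono hZ hI hQ cnt cnt' hC x x' hz hx⟩, hz⟩

/-- The back condition extends from role names to all roles that are allowed under `∀`. -/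
theorem IsComparison.role_back (hZ : IsComparison Φ M slf N slf' Z)
    (hI : Feature.I ∉ Φ) (hQ : Feature.Q ∉ Φ)
    (cnt : BasicRole Φ RN → M.Dom → Set M.Dom → Cardinal.{u})
    (cnt' : BasicRole Φ RN → N.Dom → Set N.Dom → Cardinal.{v})
    {S : Role Φ CN RN IN} (hS : SemiPosA S) (x : M.Dom) (x' y' : N.Dom) (hz : Z x x')
    (hxy : roleEval N slf' cnt' S x' y') : ∃ y, roleEval M slf cnt S x y ∧ Z y y' := by
  cases hS with
  | atom r => exact hZ.back r x x' y' hz hxy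
  | inv h => exact absurd h hI
  | eps =>
    obtain rfl : x' = y' := hxy
    exact ⟨x, rfl, hz⟩
  | comp hR hS =>
    obtain ⟨w', hw', hwy⟩ := hxy
    obtain ⟨w, hw, hzw⟩ := IsComparison.role_back hZ hI hQ cnt cnt' hR x x' w' hz hw'
    obtain ⟨y, hy, hzy⟩ := IsComparison.role_back hZ hI hQ cnt cnt' hS w w' y' hzw hwy
    exact ⟨y, ⟨w, hw, hy⟩, hzy⟩
  | union hR hS =>
    rcases hxy with h | h
    · obtain ⟨y, hy, hzy⟩ := IsComparison.role_back hZ hI hQ cnt cnt' hR x x' y' hz h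
      exact ⟨y, Or.inl hy, hzy⟩
    · obtain ⟨y, hy, hzy⟩ := IsComparison.role_back hZ hI hQ cnt cnt' hS x x' y' hz h
      exact ⟨y, Or.inr hy, hzy⟩
  | star hR =>
    have key := IsComparison.role_back hZ hI hQ cnt cnt' hR
    change Relation.ReflTransGen _ x' y' at hxy
    change ∃ y, Relation.ReflTransGen _ x y ∧ Z y y'
    induction hxy with
    | refl => exact ⟨x, .refl, hz⟩
    | tail _ h ih =>
      obtain ⟨w, hw, hzw⟩ := ih
      obtain ⟨y, hy, hzy⟩ := key _ _ _ hzw h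
      exact ⟨y, hw.tail hy, hzy⟩
  | test hC =>
    obtain ⟨rfl, hx⟩ := hxy
    exact ⟨x, ⟨rfl, fun hxC => hx
      (IsComparison.concept_mono hZ hI hQ cnt cnt' hC x x' hz hxC)⟩, hz⟩

end

end Preservation

/-- The objects with an `r`-loop, i.e. the extension of `∃ r.Self` in an interpretation. -/
abbrev loops (M : Interp.{u} CN RN IN) (r : RN) : Set M.Dom :=
  {x | M.role r x x}

theorem IsComparison.spLe {M : Interp.{u} CN RN IN} {N : Interp.{v} CN RN IN}
    {Z : M.Dom → N.Dom → Prop} (hZ : IsComparison Φ M (loops M) N (loops N) Z)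
    (hI : Feature.I ∉ Φ) (hQ : Feature.Q ∉ Φ) {x : M.Dom} {x' : N.Dom} (hz : Z x x') :
    SpLe Φ M x N x' :=
  fun _ hC hx => hZ.concept_mono hI hQ _ _ hC x x' hz hx

/-- A bisimulation is a comparison. -/
theorem IsBisimulation.isComparison {M : Interp.{u} CN RN IN} {N : Interp.{v} CN RN IN}
    {Z : M.Dom → N.Dom → Prop} (hZ : IsBisimulation Φ M N Z) :
    IsComparison Φ M (loops M) N (loops N) Z where
  concept A x x' hz := (hZ.concept A x x' hz).1
  forth r x y x' hz h := (hZ.forth r x y x' hz h).imp fun _ => And.symm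
  back r x x' y' hz h := (hZ.back r x x' y' hz h).imp fun _ => And.symm
  nominal hO a x' hz := (hZ.nominal hO a _ x' hz).1 rfl
  univ_forth := hZ.univ_forth
  univ_back := hZ.univ_back
  exSelf hS r x x' hz := (hZ.exSelf hS r x x' hz).1

/-! ### The preorder of semi-positive concepts as a comparison -/

section Preorder

variable {M : Interp.{u} CN RN IN} {N : Interp.{v} CN RN IN}

theorem SpLe.refl (Φ : Set Feature) (M : Interp.{u} CN RN IN) (x : M.Dom) : SpLe Φ M x M x :=
  fun _ _ h => h

theorem SpLe.trans {K : Interp.{w} CN RN IN} {x : M.Dom} {y : N.Dom} {z : K.Dom}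
    (h : SpLe Φ M x N y) (k : SpLe Φ N y K z) : SpLe Φ M x K z :=
  fun C hC hx => k C hC (h C hC hx)

theorem SpEquiv.symm {x : M.Dom} {y : N.Dom} (h : SpEquiv Φ M x N y) : SpEquiv Φ N y M x :=
  ⟨h.2, h.1⟩

theorem SpEquiv.trans {K : Interp.{w} CN RN IN} {x : M.Dom} {y : N.Dom} {z : K.Dom}
    (h : SpEquiv Φ M x N y) (k : SpEquiv Φ N y K z) : SpEquiv Φ M x K z :=
  ⟨h.1.trans k.1, k.2.trans h.2⟩

/-- A finite conjunction separates `x` from finitely many objects that are not above it. -/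
theorem exists_semiPos_not_mem {x : M.Dom} {s : Set N.Dom} (hs : s.Finite)
    (h : ∀ y ∈ s, ¬ SpLe Φ M x N y) :
    ∃ C : Concept Φ CN RN IN, SemiPos C ∧ x ∈ M.ext C ∧ ∀ y ∈ s, y ∉ N.ext C := by
  induction s, hs using Set.Finite.induction_on with
  | empty => exact ⟨.top, .top, trivial, fun _ h => h.elim⟩
  | @insert a s _ _ ih =>
    obtain ⟨C, hC, hx, hCs⟩ := ih fun y hy => h y (Set.mem_insert_of_mem _ hy)
    have ha := h a (Set.mem_insert _ _)
    simp only [SpLe, not_forall] at ha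
    obtain ⟨D, hD, hxD, haD⟩ := ha
    refine ⟨.and C D, .and hC hD, ⟨hx, hxD⟩, ?_⟩
    rintro y (rfl | hy) ⟨h1, h2⟩
    · exact haD h2
    · exact hCs y hy h1

/-- A finite disjunction separates finitely many objects that are not below `y` from `y`. -/
theorem exists_semiPos_mem {y : N.Dom} {s : Set M.Dom} (hs : s.Finite)
    (h : ∀ x ∈ s, ¬ SpLe Φ M x N y) :
    ∃ C : Concept Φ CN RN IN, SemiPos C ∧ (∀ x ∈ s, x ∈ M.ext C) ∧ y ∉ N.ext C := by
  induction s, hs using Set.Finite.induction_on with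
  | empty => exact ⟨.bot, .bot, fun _ h => h.elim, fun h => h⟩
  | @insert a s _ _ ih =>
    obtain ⟨C, hC, hCs, hy⟩ := ih fun x hx => h x (Set.mem_insert_of_mem _ hx)
    have ha := h a (Set.mem_insert _ _)
    simp only [SpLe, not_forall] at ha
    obtain ⟨D, hD, haD, hyD⟩ := ha
    refine ⟨.or C D, .or hC hD, ?_, fun h => h.elim hy hyD⟩
    rintro x (rfl | hx)
    · exact Or.inr haD
    · exact Or.inl (hCs x hx)

theorem SpLe.forth (hN : FinitelyBranching Φ N) {r : RN} {x y : M.Dom} {x' : N.Dom}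
    (h : SpLe Φ M x N x') (hxy : M.role r x y) : ∃ y', N.role r x' y' ∧ SpLe Φ M y N y' := by
  by_contra! hc
  obtain ⟨C, hC, hy, hn⟩ := exists_semiPos_not_mem (hN x' (.atom r)) hc
  obtain ⟨y', hy', hyC⟩ := h (.ex (.atom r) C) (.ex (.atom r) hC) ⟨y, hxy, hy⟩
  exact hn y' hy' hyC

theorem SpLe.back (hM : FinitelyBranching Φ M) {r : RN} {x : M.Dom} {x' y' : N.Dom}
    (h : SpLe Φ M x N x') (hxy : N.role r x' y') : ∃ y, M.role r x y ∧ SpLe Φ M y N y' := by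
  by_contra! hc
  obtain ⟨C, hC, hy, hn⟩ := exists_semiPos_mem (hM x (.atom r)) hc
  exact hn (h (.all (.atom r) C) (.all (.atom r) hC) hy y' hxy)

theorem SpLe.concept {A : CN} {x : M.Dom} {x' : N.Dom} (h : SpLe Φ M x N x')
    (hx : x ∈ M.concept A) : x' ∈ N.concept A :=
  h (.atom A) (.atom A) hx

theorem SpLe.nominal (hO : Feature.O ∈ Φ) {a : IN} {x' : N.Dom}
    (h : SpLe Φ M (M.ind a) N x') : x' = N.ind a :=
  h (.nominal hO a) (.nominal hO a) rfl

theorem SpLe.exSelf (hS : Feature.Self ∈ Φ) {r : RN} {x : M.Dom} {x' : N.Dom}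
    (h : SpLe Φ M x N x') (hx : M.role r x x) : N.role r x' x' :=
  h (.exSelf hS r) (.exSelf hS r) hx

/-- A relation with the forth condition that relates the named objects relates every reachable
object. -/
theorem Reachable.exists_related (hI : Feature.I ∉ Φ) {Z : M.Dom → N.Dom → Prop}
    (hind : ∀ a, Z (M.ind a) (N.ind a))
    (hforth : ∀ r x y x', Z x x' → M.role r x y → ∃ y', N.role r x' y' ∧ Z y y')
    {x : M.Dom} (hx : Reachable Φ M x) : ∃ x', Z x x' := by
  obtain ⟨a, ha⟩ := hx
  induction ha with
  | refl => exact ⟨_, hind a⟩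
  | tail _ h ih =>
    obtain ⟨R, hR⟩ := h
    obtain ⟨w', hw⟩ := ih
    cases R with
    | atom r => exact (hforth r _ _ _ hw hR).imp fun _ => And.right
    | inv h => exact absurd h hI

end Preorder

/-! ### Pruning -/

section Pruning

variable {M : Interp.{u} CN RN IN} {x : M.Dom} {S T : Set M.Dom}

theorem TidyStep.ssubset (h : TidyStep Φ M x S T) : T ⊂ S := by
  cases h with
  | equiv _ y' _ hy' => exact Set.sdiff_singleton_ssubset.2 hy'
  | between _ y' _ _ hy' => exact Set.sdiff_singleton_ssubset.2 hy'

/-- Only loops are exempt from deletion, and only if local reflexivity is expressible. -/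
theorem TidyStep.self_mem (hS : Feature.Self ∈ Φ) (h : TidyStep Φ M x S T) (hx : x ∈ S) :
    x ∈ T := by
  cases h with
  | equiv _ y' _ _ _ _ hne => exact ⟨hx, fun h => hne h.symm⟩
  | between _ y' _ _ _ _ _ _ _ _ hne =>
    exact ⟨hx, fun h => hne.elim (fun h => h hS) fun h' => h' h.symm⟩

theorem TidyStep.exists_le (h : TidyStep Φ M x S T) {z : M.Dom} (hz : z ∈ S) :
    ∃ z₁ ∈ T, SpLe Φ M z₁ M z := by
  cases h with
  | equiv y y' hy _ he hne _ =>
    by_cases hzy : z = y'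
    · subst hzy
      exact ⟨y, ⟨hy, hne⟩, he.1⟩
    · exact ⟨z, ⟨hz, hzy⟩, SpLe.refl Φ M z⟩
  | between y y' _ hy _ _ hle _ hne _ _ =>
    by_cases hzy : z = y'
    · subst hzy
      exact ⟨y, ⟨hy, fun h => hne (h ▸ ⟨SpLe.refl Φ M _, SpLe.refl Φ M _⟩)⟩, hle⟩
    · exact ⟨z, ⟨hz, hzy⟩, SpLe.refl Φ M z⟩

theorem TidyStep.exists_ge (h : TidyStep Φ M x S T) {z : M.Dom} (hz : z ∈ S) :
    ∃ z₂ ∈ T, SpLe Φ M z M z₂ := by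
  cases h with
  | equiv y y' hy _ he hne _ =>
    by_cases hzy : z = y'
    · subst hzy
      exact ⟨y, ⟨hy, hne⟩, he.2⟩
    · exact ⟨z, ⟨hz, hzy⟩, SpLe.refl Φ M z⟩
  | between _ y' y'' _ _ hy'' _ hle _ hne _ =>
    by_cases hzy : z = y'
    · subst hzy
      exact ⟨y'', ⟨hy'', fun h => hne (h ▸ ⟨SpLe.refl Φ M _, SpLe.refl Φ M _⟩)⟩, hle⟩
    · exact ⟨z, ⟨hz, hzy⟩, SpLe.refl Φ M z⟩

/-- Deletions from a finite set of successors terminate. -/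
theorem exists_reflTransGen_tidyStep (Φ : Set Feature) (M : Interp.{u} CN RN IN) (x : M.Dom)
    (S : Set M.Dom) (hS : S.Finite) :
    ∃ T, Relation.ReflTransGen (TidyStep Φ M x) S T ∧ ∀ T', ¬ TidyStep Φ M x T T' := by
  induction hn : S.ncard using Nat.strong_induction_on generalizing S with
  | _ n ih =>
    by_cases h : ∃ T, TidyStep Φ M x S T
    · obtain ⟨T, hT⟩ := h
      obtain ⟨T', hT', hmax⟩ := ih T.ncard (hn ▸ Set.ncard_lt_ncard hT.ssubset hS) T
        (hS.subset hT.ssubset.subset) rfl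
      exact ⟨T', .head hT hT', hmax⟩
    · exact ⟨S, .refl, fun T hT => h ⟨T, hT⟩⟩

theorem exists_isPruning (hM : FinitelyBranching Φ M) : ∃ E, IsPruning Φ M E := by
  choose T hT hmax using fun (r : RN) (x : M.Dom) =>
    exists_reflTransGen_tidyStep Φ M x {y | M.role r x y} (hM x (.atom r))
  exact ⟨fun r x y => y ∈ T r x, fun r x => ⟨hT r x, hmax r x⟩⟩

variable {E : RN → M.Dom → M.Dom → Prop} {r : RN} {y : M.Dom}

theorem IsPruning.subset (hE : IsPruning Φ M E) (h : E r x y) : M.role r x y := by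
  have key : ∀ T, Relation.ReflTransGen (TidyStep Φ M x) {y | M.role r x y} T →
      T ⊆ {y | M.role r x y} := by
    intro T hT
    induction hT with
    | refl => exact subset_rfl
    | tail _ hs ih => exact hs.ssubset.subset.trans ih
  exact key _ (hE r x).1 h

theorem IsPruning.self (hS : Feature.Self ∈ Φ) (hE : IsPruning Φ M E) (h : M.role r x x) :
    E r x x := by
  have key : ∀ T, Relation.ReflTransGen (TidyStep Φ M x) {y | M.role r x y} T → x ∈ T := by
    intro T hT
    induction hT with
    | refl => exact h
    | tail _ hs ih => exact hs.self_mem hS ih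
  exact key _ (hE r x).1

theorem IsPruning.exists_le (hE : IsPruning Φ M E) (h : M.role r x y) :
    ∃ y₁, E r x y₁ ∧ SpLe Φ M y₁ M y := by
  have key : ∀ T, Relation.ReflTransGen (TidyStep Φ M x) {y | M.role r x y} T →
      ∃ y₁ ∈ T, SpLe Φ M y₁ M y := by
    intro T hT
    induction hT with
    | refl => exact ⟨y, h, SpLe.refl Φ M y⟩
    | tail _ hs ih =>
      obtain ⟨y₁, hy₁, hle⟩ := ih
      obtain ⟨y₂, hy₂, hle'⟩ := hs.exists_le hy₁
      exact ⟨y₂, hy₂, hle'.trans hle⟩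
  exact key _ (hE r x).1

theorem IsPruning.exists_ge (hE : IsPruning Φ M E) (h : M.role r x y) :
    ∃ y₂, E r x y₂ ∧ SpLe Φ M y M y₂ := by
  have key : ∀ T, Relation.ReflTransGen (TidyStep Φ M x) {y | M.role r x y} T →
      ∃ y₂ ∈ T, SpLe Φ M y M y₂ := by
    intro T hT
    induction hT with
    | refl => exact ⟨y, h, SpLe.refl Φ M y⟩
    | tail _ hs ih =>
      obtain ⟨y₁, hy₁, hle⟩ := ih
      obtain ⟨y₂, hy₂, hle'⟩ := hs.exists_ge hy₁
      exact ⟨y₂, hy₂, hle.trans hle'⟩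
  exact key _ (hE r x).1

end Pruning

/-! ### Tidy reducts -/

section Reduct

variable {M : Interp.{u} CN RN IN}

theorem reachable_step {x y : M.Dom} {r : RN} (hx : Reachable Φ M x) (h : M.role r x y) :
    Reachable Φ M y :=
  hx.imp fun _ ha => ha.tail ⟨.atom r, h⟩

variable [Nonempty IN]

theorem reachablePart_unreachableObjectsFree (hI : Feature.I ∉ Φ) :
    UnreachableObjectsFree Φ (reachablePart Φ M) := by
  rintro ⟨x, a, ha⟩
  refine ⟨a, ?_⟩
  induction ha with
  | refl => exact .refl
  | @tail y z hy h ih =>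
    obtain ⟨R, hR⟩ := h
    cases R with
    | atom r => exact ih.tail ⟨.atom r, hR⟩
    | inv h => exact absurd h hI

variable {E : RN → M.Dom → M.Dom → Prop}

theorem IsPruning.reachablePart_finitelyBranching (hE : IsPruning Φ M E) (hI : Feature.I ∉ Φ)
    (hM : FinitelyBranching Φ M) :
    FinitelyBranching Φ (reachablePart Φ (M.withRoles E)) := by
  intro x R
  cases R with
  | atom r =>
    exact ((hM x.1 (.atom r)).preimage Subtype.val_injective.injOn).subset
      fun y hy => hE.subset hy
  | inv h => exact absurd h hI

/-- The semi-positive theory of an object is not changed by pruning and restriction to the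
reachable part. -/
theorem IsPruning.reachablePart_spEquiv (hE : IsPruning Φ M E) (hI : Feature.I ∉ Φ)
    (hQ : Feature.Q ∉ Φ) (hM : FinitelyBranching Φ M)
    (hU : Feature.U ∈ Φ → UnreachableObjectsFree Φ M)
    (x : (reachablePart Φ (M.withRoles E)).Dom) :
    SpEquiv Φ (reachablePart Φ (M.withRoles E)) x M x.1 := by
  let J := reachablePart Φ (M.withRoles E)
  have forth₁ : ∀ r (x y : J.Dom) (x' : M.Dom), SpLe Φ M x.1 M x' → J.role r x y →
      ∃ y', M.role r x' y' ∧ SpLe Φ M y.1 M y' :=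
    fun r x y x' hz h => hz.forth hM (hE.subset h)
  have back₁ : ∀ r (x : J.Dom) (x' y' : M.Dom), SpLe Φ M x.1 M x' → M.role r x' y' →
      ∃ y : J.Dom, J.role r x y ∧ SpLe Φ M y.1 M y' := by
    intro r x x' y' hz h
    obtain ⟨y, hy, hle⟩ := hz.back hM h
    obtain ⟨y₁, hy₁, hle₁⟩ := hE.exists_le hy
    exact ⟨⟨y₁, reachable_step x.2 hy₁⟩, hy₁, hle₁.trans hle⟩
  have forth₂ : ∀ r (x y : M.Dom) (x' : J.Dom), SpLe Φ M x M x'.1 → M.role r x y →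
      ∃ y' : J.Dom, J.role r x' y' ∧ SpLe Φ M y M y'.1 := by
    intro r x y x' hz h
    obtain ⟨y', hy', hle⟩ := hz.forth hM h
    obtain ⟨y₂, hy₂, hle₂⟩ := hE.exists_ge hy'
    exact ⟨⟨y₂, reachable_step x'.2 hy₂⟩, hy₂, hle.trans hle₂⟩
  have comp₁ : IsComparison Φ J (loops J) M (loops M) (fun x x' => SpLe Φ M x.1 M x') :=
    { concept := fun A x x' hz hx => hz.concept hx
      forth := forth₁
      back := back₁
      nominal := fun hO a x' hz => SpLe.nominal hO hz
      univ_forth := fun _ x => ⟨x.1, SpLe.refl Φ M x.1⟩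
      -- The back condition of `≤` is the forth condition of its converse.
      univ_back := fun h x' => Reachable.exists_related (M := M) (N := J)
        (Z := fun x' x => SpLe Φ M x.1 M x') hI
        (fun a => SpLe.refl Φ M (M.ind a)) (fun r x' y' x hz h => back₁ r x x' y' hz h) (hU h x')
      exSelf := fun hS r x x' hz hx => hz.exSelf hS (hE.subset hx) }
  have comp₂ : IsComparison Φ M (loops M) J (loops J) (fun x x' => SpLe Φ M x M x'.1) :=
    { concept := fun A x x' hz hx => hz.concept hx
      forth := forth₂
      back := fun r x x' y' hz h => hz.back hM (hE.subset h)
      nominal := fun hO a x' hz => Subtype.ext (SpLe.nominal (M := M) (N := M) hO hz)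
      univ_forth := fun h x => Reachable.exists_related (M := M) (N := J) hI
        (fun a => SpLe.refl Φ M (M.ind a)) forth₂ (hU h x)
      univ_back := fun _ x' => ⟨x'.1, SpLe.refl Φ M x'.1⟩
      exSelf := fun hS r x x' hz hx => IsPruning.self (M := M) hS hE (hz.exSelf hS hx) }
  exact ⟨comp₁.spLe hI hQ (SpLe.refl Φ M x.1), comp₂.spLe hI hQ (SpLe.refl Φ M x.1)⟩

theorem IsPruning.isTidy (hE : IsPruning Φ M E) (hI : Feature.I ∉ Φ)
    (hQ : Feature.Q ∉ Φ) (hM : FinitelyBranching Φ M)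
    (hU : Feature.U ∈ Φ → UnreachableObjectsFree Φ M) :
    IsTidy Φ (reachablePart Φ (M.withRoles E)) := by
  have equiv := hE.reachablePart_spEquiv hI hQ hM hU
  have le : ∀ y y' : (reachablePart Φ (M.withRoles E)).Dom,
      SpLe Φ (reachablePart Φ (M.withRoles E)) y (reachablePart Φ (M.withRoles E)) y' →
      SpLe Φ M y.1 M y'.1 :=
    fun y y' h => ((equiv y).2.trans h).trans (equiv y').1
  have eq : ∀ r (x y y' : (reachablePart Φ (M.withRoles E)).Dom), E r x.1 y.1 → E r x.1 y'.1 →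
      SpEquiv Φ M y.1 M y'.1 → y = y' := by
    intro r x y y' hy hy' he
    by_contra hne
    have hne' : y.1 ≠ y'.1 := fun h => hne (Subtype.ext h)
    -- At least one of the two objects differs from `x`, and the edge to it can be deleted.
    by_cases hx : y'.1 = x.1
    · exact (hE r x.1).2 _ (TidyStep.equiv (M := M) y'.1 y.1 hy' hy he.symm hne'.symm
        fun h => hne' (h.trans hx.symm))
    · exact (hE r x.1).2 _ (TidyStep.equiv (M := M) y.1 y'.1 hy hy' he hne' hx)
  refine ⟨hE.reachablePart_finitelyBranching hI hM, reachablePart_unreachableObjectsFree hI,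
    ?_, ?_⟩
  · intro R x y y' hy hy' he
    cases R with
    | atom r => exact eq r x y y' hy hy' ⟨le _ _ he.1, le _ _ he.2⟩
    | inv h => exact absurd h hI
  · intro R x y y' y'' hy hy' hy'' h₁ h₂
    cases R with
    | atom r =>
      by_contra! hc
      obtain ⟨hc₁, hc₂, hc₃⟩ := hc
      refine (hE r x.1).2 _ (TidyStep.between (M := M) y.1 y'.1 y''.1 hy hy' hy''
        (le _ _ h₁) (le _ _ h₂)
        (fun he => hc₁ (eq r x y y' hy hy' he)) (fun he => hc₂ (eq r x y' y'' hy' hy'' he)) ?_)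
      exact or_iff_not_imp_left.2 fun hS h => hc₃ (not_not.1 hS) (Subtype.ext h)
    | inv h => exact absurd h hI

end Reduct

/-! ### Tidy interpretations and their quotients -/

section Tidy

variable {M : Interp.{u} CN RN IN} {N : Interp.{v} CN RN IN}

/-- A successor of an object of a tidy interpretation is equivalent to some successor of any
equivalent object. -/
theorem IsTidy.exists_equiv_succ (hM : IsTidy Φ M) (hN : FinitelyBranching Φ N)
    {r : RN} {x y : M.Dom} {x' : N.Dom} (hx : SpEquiv Φ M x N x') (hy : M.role r x y) :
    ∃ y', N.role r x' y' ∧ SpEquiv Φ M y N y' := by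
  obtain ⟨y₁', hy₁', hle₁'⟩ := hx.2.back hN hy
  obtain ⟨y₁, hy₁, hle₁⟩ := hx.1.back hM.finitelyBranching hy₁'
  obtain ⟨y₂', hy₂', hle₂'⟩ := hx.1.forth hN hy
  obtain ⟨y₂, hy₂, hle₂⟩ := hx.2.forth hM.finitelyBranching hy₂'
  rcases hM.eq_of_le_of_le (.atom r) x y₁ y y₂ hy₁ hy hy₂ (hle₁.trans hle₁') (hle₂'.trans hle₂)
    with rfl | rfl | ⟨hS, rfl⟩
  · exact ⟨y₁', hy₁', hle₁, hle₁'⟩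
  · exact ⟨y₂', hy₂', hle₂', hle₂⟩
  · exact ⟨x', hx.1.exSelf hS hy, hx⟩

/-- In a tidy interpretation, equivalence with respect to semi-positive concepts is an
auto-bisimulation. -/
theorem IsTidy.isBisimulation_spEquiv (hM : IsTidy Φ M) (hI : Feature.I ∉ Φ)
    (hQ : Feature.Q ∉ Φ) : IsBisimulation Φ M M (fun x y => SpEquiv Φ M x M y) where
  ind a := ⟨SpLe.refl Φ M _, SpLe.refl Φ M _⟩
  concept _ _ _ hz := ⟨hz.1.concept, hz.2.concept⟩
  forth _ _ _ _ hz h := (hM.exists_equiv_succ hM.finitelyBranching hz h).imp fun _ => And.symm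
  back _ _ _ _ hz h := (hM.exists_equiv_succ hM.finitelyBranching hz.symm h).imp
    fun _ k => ⟨k.2.symm, k.1⟩
  inv_forth h := absurd h hI
  inv_back h := absurd h hI
  nominal hO a x x' hz := by
    constructor
    · rintro rfl
      exact hz.1.nominal hO
    · rintro rfl
      exact hz.2.nominal hO
  num h := absurd h hQ
  num_inv h := absurd h hQ
  univ_forth _ x := ⟨x, SpLe.refl Φ M x, SpLe.refl Φ M x⟩
  univ_back _ x := ⟨x, SpLe.refl Φ M x, SpLe.refl Φ M x⟩
  exSelf hS _ _ _ hz := ⟨hz.1.exSelf hS, hz.2.exSelf hS⟩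

/-- The largest auto-bisimulation of a tidy interpretation is `≡`. -/
theorem IsTidy.sim_iff_spEquiv (hM : IsTidy Φ M) (hI : Feature.I ∉ Φ) (hQ : Feature.Q ∉ Φ)
    {x y : M.Dom} : Sim Φ M x y ↔ SpEquiv Φ M x M y :=
  ⟨fun h => ⟨(Sim.isBisimulation Φ M).isComparison.spLe hI hQ h,
      (Sim.isBisimulation Φ M).symm.isComparison.spLe hI hQ h⟩,
    fun h => ⟨_, hM.isBisimulation_spEquiv hI hQ, h⟩⟩

/-- If the named objects are equivalent to their counterparts in `N`, then every object of a tidy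
interpretation is equivalent to an object of `N`. -/
theorem IsTidy.exists_spEquiv (hM : IsTidy Φ M) (hN : FinitelyBranching Φ N)
    (hI : Feature.I ∉ Φ) (hind : ∀ a, SpEquiv Φ M (M.ind a) N (N.ind a)) (x : M.Dom) :
    ∃ x', SpEquiv Φ M x N x' :=
  Reachable.exists_related hI hind (fun _ _ _ _ hz h => hM.exists_equiv_succ hN hz h)
    (hM.unreachableObjectsFree x)

theorem IsTidy.lift_mk_quot_le (hM : IsTidy Φ M) (hN : FinitelyBranching Φ N)
    (hI : Feature.I ∉ Φ) (hQ : Feature.Q ∉ Φ)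
    (hind : ∀ a, SpEquiv Φ M (M.ind a) N (N.ind a)) :
    Cardinal.lift.{v} (Cardinal.mk (quot Φ M).Dom) ≤ Cardinal.lift.{u} (Cardinal.mk N.Dom) := by
  choose f hf using hM.exists_spEquiv hN hI hind
  refine Cardinal.lift_mk_le'.2 ⟨⟨fun q => f (Quotient.out q), fun p q hpq => ?_⟩⟩
  refine Quotient.out_equiv_out.1 ((hM.sim_iff_spEquiv hI hQ).2 ((hf _).trans ?_))
  have h := (hf (Quotient.out q)).symm
  rwa [← show f (Quotient.out p) = f (Quotient.out q) from hpq] at h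

/-- In a tidy interpretation, an object has at most one `R`-successor in each class. -/
theorem IsTidy.hasQuotQS (hM : IsTidy Φ M) (hI : Feature.I ∉ Φ) (hQ : Feature.Q ∉ Φ) :
    HasQuotQS Φ M := by
  refine fun R p q => ⟨1, fun x _ => ?_⟩
  rw [Nat.cast_one, Set.encard_le_one_iff]
  rintro y y' ⟨hy, hxy⟩ ⟨hy', hxy'⟩
  exact hM.eq_of_equiv R x y y' hxy hxy'
    ((hM.sim_iff_spEquiv hI hQ).1 (Quotient.exact (hy.trans hy'.symm)))

theorem sim_of_simClass_eq {x y : M.Dom} (h : simClass Φ M x = simClass Φ M y) : Sim Φ M x y :=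
  Quotient.exact h

theorem simClass_eq {x y : M.Dom} (h : Sim Φ M x y) : simClass Φ M x = simClass Φ M y :=
  Quotient.sound (s := simSetoid Φ M) h

theorem exists_role_of_quot_role {r : RN} {x : M.Dom} {q : (quot Φ M).Dom}
    (h : (quot Φ M).role r (simClass Φ M x) q) : ∃ y, M.role r x y ∧ simClass Φ M y = q := by
  obtain ⟨x₁, y₁, hx₁, rfl, h⟩ := h
  obtain ⟨y, hy, hxy⟩ := (Sim.isBisimulation Φ M).forth r x₁ y₁ x (sim_of_simClass_eq hx₁) h
  exact ⟨y, hxy, (simClass_eq hy).symm⟩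

theorem simClass_eq_ind (hO : Feature.O ∈ Φ) {a : IN} {x : M.Dom}
    (h : simClass Φ M x = simClass Φ M (M.ind a)) : x = M.ind a :=
  ((Sim.isBisimulation Φ M).nominal hO a x _ (sim_of_simClass_eq h)).2 rfl

/-- The extension of `∃ r.Self` that the quotient inherits from `M`. -/
abbrev quotLoops (Φ : Set Feature) (M : Interp.{u} CN RN IN) (r : RN) : Set (quot Φ M).Dom :=
  {q | ∃ x, simClass Φ M x = q ∧ M.role r x x}

variable {slf : RN → Set (quot Φ M).Dom}

theorem isComparison_simClass (hslf : Feature.Self ∈ Φ → slf = quotLoops Φ M) :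
    IsComparison Φ M (loops M) (quot Φ M) slf (fun x q => simClass Φ M x = q) where
  concept A x q hz hx := ⟨x, hz, hx⟩
  forth r x y q hz h := ⟨_, ⟨x, y, hz, rfl, h⟩, rfl⟩
  back := by
    rintro r x _ q rfl h
    exact exists_role_of_quot_role h
  nominal _ a q hz := hz.symm
  univ_forth _ x := ⟨_, rfl⟩
  univ_back _ q := Quotient.exists_rep q
  exSelf hS r x q hz hx := hslf hS ▸ ⟨x, hz, hx⟩

theorem isComparison_simClass_flip (hslf : Feature.Self ∈ Φ → slf = quotLoops Φ M) :
    IsComparison Φ (quot Φ M) slf M (loops M) (fun q x => simClass Φ M x = q) where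
  concept := by
    rintro A _ x rfl ⟨x₁, hx₁, h⟩
    exact ((Sim.isBisimulation Φ M).concept A x₁ x (sim_of_simClass_eq hx₁)).1 h
  forth := by
    rintro r _ q x rfl h
    exact exists_role_of_quot_role h
  back r q x y hz h := ⟨_, ⟨x, y, hz, rfl, h⟩, rfl⟩
  nominal hO a x hz := simClass_eq_ind hO hz
  univ_forth _ q := Quotient.exists_rep q
  univ_back _ x := ⟨_, rfl⟩
  exSelf := by
    rintro hS r _ x rfl hx
    rw [hslf hS] at hx
    obtain ⟨x₁, hx₁, h⟩ := hx
    exact ((Sim.isBisimulation Φ M).exSelf hS r x₁ x (sim_of_simClass_eq hx₁)).1 h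

/-- The quotient, under any choice of multiplicities, satisfies the same semi-positive assertions
as `M`. If local reflexivity is expressible, `∃ r.Self` has to be interpreted by the classes of
the reflexive objects and not by the loops of the quotient. -/
theorem ind_mem_conceptEval_quot_iff (hI : Feature.I ∉ Φ) (hQ : Feature.Q ∉ Φ)
    (hslf : Feature.Self ∈ Φ → slf = quotLoops Φ M)
    (cnt : BasicRole Φ RN → (quot Φ M).Dom → Set (quot Φ M).Dom → Cardinal.{u})
    {C : Concept Φ CN RN IN} (hC : SemiPos C) (a : IN) :
    (quot Φ M).ind a ∈ conceptEval (quot Φ M) slf cnt C ↔ M.Satisfies C a :=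
  ⟨(isComparison_simClass_flip hslf).concept_mono hI hQ _ _ hC _ _ rfl,
    (isComparison_simClass hslf).concept_mono hI hQ _ _ hC _ _ rfl⟩

end Tidy

end DL

theorem mainTheorem5 {CN : Type w₁} {RN : Type w₂} {IN : Type w₃}
    [Finite CN] [Finite RN] [Finite IN] [Nonempty IN]
    (Φ : Set DL.Feature) (hΦ : Φ ⊆ {DL.Feature.O, DL.Feature.U, DL.Feature.Self})
    (I₀ : DL.Interp.{u} CN RN IN) (I₀' : DL.Interp.{v} CN RN IN)
    (hfin : DL.FinitelyBranching Φ I₀) (hfin' : DL.FinitelyBranching Φ I₀')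
    (hU : DL.Feature.U ∈ Φ → DL.UnreachableObjectsFree Φ I₀)
    (hU' : DL.Feature.U ∈ Φ → DL.UnreachableObjectsFree Φ I₀')
    (hsame : ∀ C : DL.Concept Φ CN RN IN, DL.SemiPos C →
      ∀ a : IN, I₀.Satisfies C a ↔ I₀'.Satisfies C a) :
    (∃ J, DL.IsTidyReduct Φ I₀ J) ∧
    ∀ J, DL.IsTidyReduct Φ I₀ J →
      DL.IsTidy Φ J ∧
      (DL.Feature.Self ∉ Φ →
        (∀ C : DL.Concept Φ CN RN IN, DL.SemiPos C →
          ∀ a : IN, (DL.quot Φ J).Satisfies C a ↔ I₀'.Satisfies C a) ∧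
        Cardinal.lift.{v} (Cardinal.mk (DL.quot Φ J).Dom) ≤
          Cardinal.lift.{u} (Cardinal.mk I₀'.Dom)) ∧
      (DL.Feature.Self ∈ Φ → ∃ h : DL.HasQuotQS Φ J,
        (∀ C : DL.Concept Φ CN RN IN, DL.SemiPos C →
          ∀ a : IN, (DL.quotQS Φ J h).Satisfies C a ↔ I₀'.Satisfies C a) ∧
        Cardinal.lift.{v} (Cardinal.mk (DL.quotQS Φ J h).Dom) ≤
          Cardinal.lift.{u} (Cardinal.mk I₀'.Dom)) := by
  have hI : DL.Feature.I ∉ Φ := fun h => by simpa using hΦ h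
  have hQ : DL.Feature.Q ∉ Φ := fun h => by simpa using hΦ h
  refine ⟨(DL.exists_isPruning hfin).elim fun E hE => ⟨_, E, hE, rfl⟩, ?_⟩
  rintro _ ⟨E, hE, rfl⟩
  have hJ := hE.isTidy hI hQ hfin hU
  have hind : ∀ a : IN, DL.SpEquiv Φ (DL.reachablePart Φ (I₀.withRoles E))
      ((DL.reachablePart Φ (I₀.withRoles E)).ind a) I₀' (I₀'.ind a) := fun a =>
    (hE.reachablePart_spEquiv hI hQ hfin hU _).trans
      ⟨fun C hC => (hsame C hC a).1, fun C hC => (hsame C hC a).2⟩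
  have hcard := hJ.lift_mk_quot_le hfin' hI hQ hind
  refine ⟨hJ, fun hS => ⟨fun C hC a => ?_, hcard⟩,
    fun hS => ⟨hJ.hasQuotQS hI hQ, fun C hC a => ?_, hcard⟩⟩
  · exact (DL.ind_mem_conceptEval_quot_iff hI hQ (fun h => absurd h hS) _ hC a).trans
      ⟨(hind a).1 C hC, (hind a).2 C hC⟩
  · exact (DL.ind_mem_conceptEval_quot_iff hI hQ (fun _ => rfl) _ hC a).trans
      ⟨(hind a).1 C hC, (hind a).2 C hC⟩
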